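/- Let $\mathcal V$ be a commutative unital quantale with multiplication $\otimes$ and unit $k$, which is integral ($k=\top$) and whose underlying complete lattice is continuous; let $B\subseteq\mathcal V$ be a basis of this lattice (for every $x$, the set of all $y\in B$ that are way-below $x$ is directed with least upper bound $x$) that is closed under finite joins and under $\otimes$ and contains $k$. Let $\mathsf C$ be a locally small autonomous (symmetric monoidal closed) category enriched over separated $\mathcal V$-categories: every hom-set is a separated $\mathcal V$-category, composition and the bifunctor $\otimes$ are $\mathcal V$-functors on hom-objects, and $(-\otimes X)\dashv(X\multimap -)$ is an enriched adjunction. Let $\mathrm{Lang}(\mathsf C)$ be the linear $\mathcal V\lambda$-theory whose ground types are the objects of $\mathsf C$; whose operation symbols are the morphisms of $\mathsf C$, together with symbols $\mathbb A\to i(\mathbb A)$ and $i(\mathbb A)\to\mathbb A$ for every type $\mathbb A$ (interpreted by identities), where $i(\mathbb A)$ is the object of $\mathsf C$ obtained by reading $\mathbb I,\otimes,\multimap$ in $\mathsf C$; and whose axioms are all $\mathcal V$-equations-in-context $\Gamma\rhd v=_q w:\mathbb A$, $q\in B$, with $a(\llbracket v\rrbracket,\llbracket w\rrbracket)\ge q$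 in $\mathsf C(\llbracket\Gamma\rrbracket,\llbracket\mathbb A\rrbracket)$. Its theorems are the $\mathcal V$-equations obtained from the axioms and from the equations of linear $\lambda$-calculus (each such $v=w$ read as $v=_\top w$ and $w=_\top v$) by the rules of $\mathcal V$-congruence (reflexivity, transitivity, weakening, the Archimedean and finite join rules, compatibility with all term formers, exchange, substitution). For types $\mathbb A,\mathbb B$ let $\mathrm{Syn}(\mathrm{Lang}(\mathsf C))(\mathbb A,\mathbb B)$ be the separated quotient of the (possibly large) $\mathcal V$-category of all terms $v$ with $x:\mathbb A\rhd v:\mathbb B$, with $a(v,w)=\bigvee\{q\mid v=_q w\text{ is a theorem}\}$. Then $\mathrm{Lang}(\mathsf C)$ is varietal: for all types $\mathbb A,\mathbb B$ the $\mathcal V$-category $\mathrm{Syn}(\mathrm{Lang}(\mathsf C))(\mathbb A,\mathbb B)$ is small. Moreover, let $\mathrm{Lang}^\lambda(\mathsf C)$ be the ordinary linear $\lambda$-theory with the same types and operation symbols, whose axioms are all equations-in-context $\Gamma\rhd v=w:\mathbb A$ with $\llbracket v\rrbracket=\llbracket w\rrbracket$ in $\mathsf C$, and let $\mathrm{Syn}(\mathrm{Lang}^\lambda(\mathsf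 C))(\mathbb A,\mathbb B)$ be the class of terms $x:\mathbb A\rhd v:\mathbb B$ modulo provable equality. Then $[v]\mapsto[v]$ is a well-defined surjection $$\mathrm{Syn}(\mathrm{Lang}^\lambda(\mathsf C))(\mathbb A,\mathbb B)\longrightarrow\mathrm{Syn}(\mathrm{Lang}(\mathsf C))(\mathbb A,\mathbb B).$$ -/

import Mathlib

open CategoryTheory MonoidalCategory

universe w v u u'

/-- `y` is way-below `x`. -/
def WayBelow {L : Type w} [CompleteLattice L] (y x : L) : Prop :=
  ∀ X : Set L, x ≤ sSup X → ∃ A : Finset L, (A : Set L) ⊆ X ∧ y ≤ A.sup id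

/-- A complete lattice is continuous if every element is the join of the elements way-below it. -/
def IsContinuousLattice (L : Type w) [CompleteLattice L] : Prop :=
  ∀ x : L, x = sSup {y | WayBelow y x}

/-- `B` is a basis of the complete lattice `L`: for every `x` the elements of `B` that are way-below
`x` form a (nonempty) directed set with least upper bound `x`. -/
def IsLatticeBasis {L : Type w} [CompleteLattice L] (B : Set L) : Prop :=
  ∀ x : L, (B ∩ {y | WayBelow y x}).Nonempty ∧
    DirectedOn (· ≤ ·) (B ∩ {y | WayBelow y x}) ∧ IsLUB (B ∩ {y | WayBelow y x}) x

/-- A `V`-category structure on `X`; the unit `k` of the quantale is `1`, its multiplication `*`. -/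
structure VCatStr (V : Type w) [CommMonoid V] [CompleteLattice V] (X : Type u) where
  a : X → X → V
  one_le : ∀ x, 1 ≤ a x x
  mul_le : ∀ x y z, a x y * a y z ≤ a x z

namespace VCatStr

variable {V : Type w} [CommMonoid V] [CompleteLattice V] {X : Type u} {Y : Type u'}

/-- Antisymmetry of the natural order `x ≤ y :↔ k ≤ a x y`. -/
def IsSeparated (𝒳 : VCatStr V X) : Prop :=
  ∀ x y, 1 ≤ 𝒳.a x y → 1 ≤ 𝒳.a y x → x = y

/-- The `V`-category `X` is small relative to the universe `v`. -/
def IsSmall (_𝒳 : VCatStr V X) : Prop := Small.{v} X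

/-- `f` is a `V`-functor. -/
def IsVFunctor (𝒳 : VCatStr V X) (𝒴 : VCatStr V Y) (f : X → Y) : Prop :=
  ∀ x x', 𝒳.a x x' ≤ 𝒴.a (f x) (f x')

variable [IsQuantale V]

/-- The tensor product of `V`-categories. -/
def tensor (𝒳 : VCatStr V X) (𝒴 : VCatStr V Y) : VCatStr V (X × Y) where
  a p q := 𝒳.a p.1 q.1 * 𝒴.a p.2 q.2
  one_le p := by
    simpa using mul_le_mul' (𝒳.one_le p.1) (𝒴.one_le p.2)
  mul_le p q r := by
    calc 𝒳.a p.1 q.1 * 𝒴.a p.2 q.2 * (𝒳.a q.1 r.1 * 𝒴.a q.2 r.2)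
        = (𝒳.a p.1 q.1 * 𝒳.a q.1 r.1) * (𝒴.a p.2 q.2 * 𝒴.a q.2 r.2) :=
          mul_mul_mul_comm _ _ _ _
      _ ≤ _ := mul_le_mul' (𝒳.mul_le _ _ _) (𝒴.mul_le _ _ _)

/-- `x ∼ y` if `x ≤ y` and `y ≤ x` in the natural order. -/
def sepSetoid (𝒳 : VCatStr V X) : Setoid X where
  r x y := 1 ≤ 𝒳.a x y ∧ 1 ≤ 𝒳.a y x
  iseqv :=
    { refl := fun x => ⟨𝒳.one_le x, 𝒳.one_le x⟩
      symm := fun h => ⟨h.2, h.1⟩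
      trans := fun {x y z} h h' =>
        ⟨le_trans (by simpa using mul_le_mul' h.1 h'.1) (𝒳.mul_le x y z),
         le_trans (by simpa using mul_le_mul' h'.2 h.2) (𝒳.mul_le z y x)⟩ }

/-- The underlying class of the separated quotient. -/
def SepQuot (𝒳 : VCatStr V X) : Type u := Quotient 𝒳.sepSetoid

theorem a_le_of_equiv (𝒳 : VCatStr V X) {x x' y y' : X}
    (hx : 1 ≤ 𝒳.a x' x) (hy : 1 ≤ 𝒳.a y y') : 𝒳.a x y ≤ 𝒳.a x' y' := by
  calc 𝒳.a x y = 1 * 𝒳.a x y * 1 := by simp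
    _ ≤ 𝒳.a x' x * 𝒳.a x y * 𝒳.a y y' := mul_le_mul' (mul_le_mul' hx le_rfl) hy
    _ ≤ 𝒳.a x' y * 𝒳.a y y' := mul_le_mul' (𝒳.mul_le _ _ _) le_rfl
    _ ≤ _ := 𝒳.mul_le _ _ _

/-- The quotient `V`-category, with `ã [x] [y] = a x y`. -/
def sepQuot (𝒳 : VCatStr V X) : VCatStr V 𝒳.SepQuot where
  a := Quotient.lift₂ 𝒳.a (fun _ _ _ _ hx hy =>
    le_antisymm (𝒳.a_le_of_equiv hx.2 hy.1) (𝒳.a_le_of_equiv hx.1 hy.2))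
  one_le := by rintro ⟨x⟩; exact 𝒳.one_le x
  mul_le := by rintro ⟨x⟩ ⟨y⟩ ⟨z⟩; exact 𝒳.mul_le x y z

theorem sepQuot_isSeparated (𝒳 : VCatStr V X) : 𝒳.sepQuot.IsSeparated := by
  rintro ⟨x⟩ ⟨y⟩ h h'
  exact Quotient.sound ⟨h, h'⟩

end VCatStr

/-- The right transpose `X ⟶ (Y ⊸ Z)` of `X ⊗ Y ⟶ Z` for the adjunction `(- ⊗ Y) ⊣ (Y ⊸ -)`.
(Mathlib's `MonoidalClosed.curry` transposes maps out of `Y ⊗ X`.) -/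
def transpose {C : Type u} [Category.{v} C] [MonoidalCategory C] [SymmetricCategory C]
    [MonoidalClosed C] {X Y Z : C} (f : X ⊗ Y ⟶ Z) : X ⟶ (ihom Y).obj Z :=
  MonoidalClosed.curry ((β_ Y X).hom ≫ f)

/-- The application morphism `(X ⊸ Y) ⊗ X ⟶ Y`. -/
def application {C : Type u} [Category.{v} C] [MonoidalCategory C] [SymmetricCategory C]
    [MonoidalClosed C] (X Y : C) : (ihom X).obj Y ⊗ X ⟶ Y :=
  (β_ ((ihom X).obj Y) X).hom ≫ (ihom.ev X).app Y

/-- The data making the autonomous (symmetric monoidal closed) category `C` a `V-Cat_sep`-enriched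
autonomous category: hom-sets are separated `V`-categories, composition and the tensor bifunctor
are `V`-functors, and `(- ⊗ X) ⊣ (X ⊸ -)` is an enriched adjunction. -/
structure VCatSepAutonomous (V : Type w) [CommMonoid V] [CompleteLattice V] [IsQuantale V]
    (C : Type u) [Category.{v} C] [MonoidalCategory C] [SymmetricCategory C]
    [MonoidalClosed C] where
  hom : ∀ X Y : C, VCatStr V (X ⟶ Y)
  separated : ∀ X Y : C, (hom X Y).IsSeparated
  comp : ∀ X Y Z : C, VCatStr.IsVFunctor ((hom X Y).tensor (hom Y Z)) (hom X Z)
    (fun p => p.1 ≫ p.2)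
  tensor : ∀ X Y X' Y' : C, VCatStr.IsVFunctor ((hom X Y).tensor (hom X' Y'))
    (hom (X ⊗ X') (Y ⊗ Y')) (fun p => p.1 ⊗ₘ p.2)
  tensorRight : ∀ X Y Z : C, VCatStr.IsVFunctor (hom Y Z) (hom (Y ⊗ X) (Z ⊗ X)) (fun f => f ▷ X)
  ihom : ∀ X Y Z : C, VCatStr.IsVFunctor (hom Y Z) (hom ((ihom X).obj Y) ((ihom X).obj Z))
    (fun f => (CategoryTheory.ihom X).map f)
  transpose : ∀ (X Y Z : C) (f g : X ⊗ Y ⟶ Z),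
    (hom X ((CategoryTheory.ihom Y).obj Z)).a (transpose f) (transpose g) = (hom (X ⊗ Y) Z).a f g

namespace LinearLambda

/-- Types of linear lambda-calculus over a class `G` of ground types. -/
inductive Ty (G : Type u) : Type u
  | ground (X : G) : Ty G
  | unit : Ty G
  | tensor (A B : Ty G) : Ty G
  | lolli (A B : Ty G) : Ty G

/-- Typing contexts, *read from right to left*: the context `x₁ : A₁, …, xₙ : Aₙ` is `[Aₙ, …, A₁]`,
so that `A :: Γ` is the context `Γ, x : A`. Variables are the positions of the list; this is
the usual nameless presentation of terms up to renaming of free and bound variables. -/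
abbrev Ctx (G : Type u) : Type u := List (Ty G)

/-- A class of sorted operation symbols `f : A₁, …, Aₙ → A` with `n ≥ 1`; the list `dom f` is
`[Aₙ, …, A₁]`, read from right to left like contexts. -/
structure Signature (G : Type u) where
  Op : Type u'
  dom : Op → List (Ty G)
  dom_ne_nil : ∀ f, dom f ≠ []
  cod : Op → Ty G

/-- `Shuffle Γ Δ E` is the type of ways in which `E` is a shuffle of `Γ` and `Δ`: every position of
`E` is assigned to `Γ` or to `Δ`, and the relative orders are kept. -/
inductive Shuffle {α : Type u} : List α → List α → List α → Type u
  | nil : Shuffle [] [] []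
  | left {A : α} {Γ Δ E : List α} (s : Shuffle Γ Δ E) : Shuffle (A :: Γ) Δ (A :: E)
  | right {A : α} {Γ Δ E : List α} (s : Shuffle Γ Δ E) : Shuffle Γ (A :: Δ) (A :: E)

/-- `Ins A Γ E` is the type of ways in which `E` arises by inserting `A` somewhere in `Γ`. -/
inductive Ins {α : Type u} (A : α) : List α → List α → Type u
  | here {Γ : List α} : Ins A Γ (A :: Γ)
  | there {B : α} {Γ E : List α} (i : Ins A Γ E) : Ins A (B :: Γ) (B :: E)

/-- `Permut Γ Δ` is the type of permutations of the positions that take `Γ` to `Δ`. -/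
inductive Permut {α : Type u} : List α → List α → Type u
  | nil : Permut [] []
  | cons {A : α} {Γ Δ Δ' : List α} (i : Ins A Δ Δ') (p : Permut Γ Δ) : Permut (A :: Γ) Δ'

namespace Shuffle

variable {α : Type u}

theorem eq_of_nil_left : ∀ {Δ E : List α}, Shuffle [] Δ E → Δ = E
  | _, _, .nil => rfl
  | _, _, .right s => congrArg _ (eq_of_nil_left s)

/-- The trivial shuffle of `Γ` with the empty context on the right. -/
def leftAll : ∀ Γ : List α, Shuffle Γ [] Γ
  | [] => .nil
  | _ :: Γ => .left (leftAll Γ)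

/-- The trivial shuffle of `Γ` with the empty context on the left. -/
def rightAll : ∀ Γ : List α, Shuffle [] Γ Γ
  | [] => .nil
  | _ :: Γ => .right (rightAll Γ)

/-- Exchange the roles of the two shuffled contexts. -/
def symm : ∀ {Γ Δ E : List α}, Shuffle Γ Δ E → Shuffle Δ Γ E
  | _, _, _, .nil => .nil
  | _, _, _, .left s => .right s.symm
  | _, _, _, .right s => .left s.symm

/-- A shuffle of `(Γ₁; Γ₂)` and `Δ` is a shuffle of `Γ₁` and `(Γ₂; Δ)`. -/
def assoc : ∀ {Γ₁ Γ₂ Γ Δ F : List α}, Shuffle Γ₁ Γ₂ Γ → Shuffle Γ Δ F →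
    Σ F₂ : List α, Shuffle Γ₂ Δ F₂ × Shuffle Γ₁ F₂ F
  | _, _, _, _, _, .nil, .nil => ⟨_, .nil, .nil⟩
  | _, _, _, _, _, s, .right t =>
    let r := assoc s t
    ⟨_, .right r.2.1, .right r.2.2⟩
  | _, _, _, _, _, .left s, .left t =>
    let r := assoc s t
    ⟨_, r.2.1, .left r.2.2⟩
  | _, _, _, _, _, .right s, .left t =>
    let r := assoc s t
    ⟨_, .left r.2.1, .right r.2.2⟩

/-- If `E` shuffles `E₁` and `E₂`, then a variable of `E` lies either in `E₁` or in `E₂`; removing it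
leaves a shuffle of what remains. -/
def locate {A : α} : ∀ {E₁ E₂ E Γ : List α}, Shuffle E₁ E₂ E → Ins A Γ E →
    (Σ Γ₁ : List α, Ins A Γ₁ E₁ × Shuffle Γ₁ E₂ Γ) ⊕ (Σ Γ₂ : List α, Ins A Γ₂ E₂ × Shuffle E₁ Γ₂ Γ)
  | _, _, _, _, .left s, .here => .inl ⟨_, .here, s⟩
  | _, _, _, _, .right s, .here => .inr ⟨_, .here, s⟩
  | _, _, _, _, .left s, .there i =>
    match locate s i with
    | .inl r => .inl ⟨_, .there r.2.1, .left r.2.2⟩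
    | .inr r => .inr ⟨_, r.2.1, .left r.2.2⟩
  | _, _, _, _, .right s, .there i =>
    match locate s i with
    | .inl r => .inl ⟨_, r.2.1, .right r.2.2⟩
    | .inr r => .inr ⟨_, .there r.2.1, .right r.2.2⟩

/-- Insert a variable into a shuffled context and assign it to the left part. -/
def insertLeft {A : α} : ∀ {Γ Δ E E' : List α}, Shuffle Γ Δ E → Ins A E E' →
    Σ Γ' : List α, Ins A Γ Γ' × Shuffle Γ' Δ E'
  | _, _, _, _, s, .here => ⟨_, .here, .left s⟩
  | _, _, _, _, .left s, .there i =>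
    let r := insertLeft s i
    ⟨_, .there r.2.1, .left r.2.2⟩
  | _, _, _, _, .right s, .there i =>
    let r := insertLeft s i
    ⟨_, r.2.1, .right r.2.2⟩

/-- Permuting a shuffled context permutes the two parts. -/
def permute : ∀ {Γ Δ E E' : List α}, Shuffle Γ Δ E → Permut E E' →
    Σ Γ' Δ' : List α, Permut Γ Γ' × Permut Δ Δ' × Shuffle Γ' Δ' E'
  | _, _, _, _, .nil, .nil => ⟨_, _, .nil, .nil, .nil⟩
  | _, _, _, _, .left s, .cons i p =>
    let r := permute s p
    let t := insertLeft r.2.2.2.2 i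
    ⟨_, _, .cons t.2.1 r.2.2.1, r.2.2.2.1, t.2.2⟩
  | _, _, _, _, .right s, .cons i p =>
    let r := permute s p
    let t := insertLeft r.2.2.2.2.symm i
    ⟨_, _, r.2.2.1, .cons t.2.1 r.2.2.2.1, t.2.2.symm⟩

end Shuffle

mutual

/-- `Term S Γ A` is the class of terms `v` with `Γ ▹ v : A`, that is, of derivations of such
judgements (derivations are unique) by the term formation rules of linear lambda-calculus. -/
inductive Term {G : Type u} (S : Signature.{u, u'} G) : Ctx G → Ty G → Type (max u u')
  | op (f : S.Op) {E : Ctx G} (vs : Args S E (S.dom f)) : Term S E (S.cod f)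
  | var (A : Ty G) : Term S [A] A
  | star : Term S [] .unit
  /-- `v to *. w` -/
  | letStar {Γ Δ E : Ctx G} {A : Ty G} (v : Term S Γ .unit) (w : Term S Δ A)
      (s : Shuffle Γ Δ E) : Term S E A
  /-- `v ⊗ w` -/
  | pair {Γ Δ E : Ctx G} {A B : Ty G} (v : Term S Γ A) (w : Term S Δ B)
      (s : Shuffle Γ Δ E) : Term S E (.tensor A B)
  /-- `pm v to x ⊗ y. w` -/
  | pm {Γ Δ E : Ctx G} {A B D : Ty G} (v : Term S Γ (.tensor A B)) (w : Term S (B :: A :: Δ) D)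
      (s : Shuffle Γ Δ E) : Term S E D
  | lam {Γ : Ctx G} {A B : Ty G} (v : Term S (A :: Γ) B) : Term S Γ (.lolli A B)
  | app {Γ Δ E : Ctx G} {A B : Ty G} (v : Term S Γ (.lolli A B)) (w : Term S Δ A)
      (s : Shuffle Γ Δ E) : Term S E B

/-- `Args S E [Aₙ, …, A₁]` is the class of tuples `v₁, …, vₙ` with `Γᵢ ▹ vᵢ : Aᵢ` together with a
presentation of `E` as a shuffle of `Γ₁; …; Γₙ`. -/
inductive Args {G : Type u} (S : Signature.{u, u'} G) : Ctx G → List (Ty G) → Type (max u u')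
  | nil : Args S [] []
  | snoc {Γ Δ E : Ctx G} {As : List (Ty G)} {A : Ty G} (vs : Args S Γ As) (v : Term S Δ A)
      (s : Shuffle Γ Δ E) : Args S E (A :: As)

end

section Operations

variable {G : Type u} {S : Signature.{u, u'} G}

mutual

/-- Exchange: the same term in a permuted context. -/
def Term.permute : ∀ {Γ Δ : Ctx G} {A : Ty G}, Term S Γ A → Permut Γ Δ → Term S Δ A
  | _, _, _, .op f vs, p => .op f (vs.permute p)
  | _, _, _, .var A, .cons .here .nil => .var A
  | _, _, _, .star, .nil => .star
  | _, _, _, .letStar v w s, p =>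
    let r := s.permute p
    .letStar (v.permute r.2.2.1) (w.permute r.2.2.2.1) r.2.2.2.2
  | _, _, _, .pair v w s, p =>
    let r := s.permute p
    .pair (v.permute r.2.2.1) (w.permute r.2.2.2.1) r.2.2.2.2
  | _, _, _, .pm v w s, p =>
    let r := s.permute p
    .pm (v.permute r.2.2.1) (w.permute (.cons .here (.cons .here r.2.2.2.1))) r.2.2.2.2
  | _, _, _, .lam v, p => .lam (v.permute (.cons .here p))
  | _, _, _, .app v w s, p =>
    let r := s.permute p
    .app (v.permute r.2.2.1) (w.permute r.2.2.2.1) r.2.2.2.2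

/-- Exchange for tuples of terms. -/
def Args.permute : ∀ {Γ Δ : Ctx G} {As : List (Ty G)}, Args S Γ As → Permut Γ Δ → Args S Δ As
  | _, _, _, .nil, .nil => .nil
  | _, _, _, .snoc vs v s, p =>
    let r := s.permute p
    .snoc (vs.permute r.2.2.1) (v.permute r.2.2.2.1) r.2.2.2.2

end

mutual

/-- Substitution `v[w/x]`, where `x : A` is the variable of `E` singled out by `i`, the remaining
variables of `E` form `Γ`, and the result lives in a given shuffle `F` of `Γ` and `Δ`. -/
def Term.subst {A : Ty G} {Δ : Ctx G} (w : Term S Δ A) : ∀ {E Γ F : Ctx G} {B : Ty G},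
    Term S E B → Ins A Γ E → Shuffle Γ Δ F → Term S F B
  | _, _, _, _, .op f vs, i, t => .op f (vs.subst w i t)
  | _, _, _, _, .var _, .here, t => t.eq_of_nil_left ▸ w
  | _, _, _, _, .letStar v v' s, i, t =>
    match s.locate i with
    | .inl r =>
      let q := r.2.2.symm.assoc t
      .letStar (Term.subst w v r.2.1 q.2.1) v' q.2.2.symm
    | .inr r =>
      let q := r.2.2.assoc t
      .letStar v (Term.subst w v' r.2.1 q.2.1) q.2.2
  | _, _, _, _, .pair v v' s, i, t =>
    match s.locate i with
    | .inl r =>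
      let q := r.2.2.symm.assoc t
      .pair (Term.subst w v r.2.1 q.2.1) v' q.2.2.symm
    | .inr r =>
      let q := r.2.2.assoc t
      .pair v (Term.subst w v' r.2.1 q.2.1) q.2.2
  | _, _, _, _, .pm v v' s, i, t =>
    match s.locate i with
    | .inl r =>
      let q := r.2.2.symm.assoc t
      .pm (Term.subst w v r.2.1 q.2.1) v' q.2.2.symm
    | .inr r =>
      let q := r.2.2.assoc t
      .pm v (Term.subst w v' (.there (.there r.2.1)) (.left (.left q.2.1))) q.2.2
  | _, _, _, _, .lam v, i, t => .lam (Term.subst w v (.there i) (.left t))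
  | _, _, _, _, .app v v' s, i, t =>
    match s.locate i with
    | .inl r =>
      let q := r.2.2.symm.assoc t
      .app (Term.subst w v r.2.1 q.2.1) v' q.2.2.symm
    | .inr r =>
      let q := r.2.2.assoc t
      .app v (Term.subst w v' r.2.1 q.2.1) q.2.2

/-- Substitution in tuples of terms. -/
def Args.subst {A : Ty G} {Δ : Ctx G} (w : Term S Δ A) : ∀ {E Γ F : Ctx G} {As : List (Ty G)},
    Args S E As → Ins A Γ E → Shuffle Γ Δ F → Args S F As
  | _, _, _, _, .snoc vs v s, i, t =>
    match s.locate i with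
    | .inl r =>
      let q := r.2.2.symm.assoc t
      .snoc (Args.subst w vs r.2.1 q.2.1) v q.2.2.symm
    | .inr r =>
      let q := r.2.2.assoc t
      .snoc vs (Term.subst w v r.2.1 q.2.1) q.2.2

end

/-- For `Γ, x : A ▹ v : B` and `Δ ▹ w : A`, the term `v[w/x]` in a shuffle `E` of `Γ` and `Δ`. -/
abbrev Term.inst {Γ Δ E : Ctx G} {A B : Ty G} (v : Term S (A :: Γ) B) (w : Term S Δ A)
    (s : Shuffle Γ Δ E) : Term S E B :=
  Term.subst w v .here s

/-- The equations-in-context corresponding to the axiomatics of autonomous categories. -/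
inductive BaseEq : ∀ {Γ : Ctx G} {A : Ty G}, Term S Γ A → Term S Γ A → Prop
  /-- `pm v ⊗ w to x ⊗ y. u = u[v/x, w/y]` -/
  | pm_beta {Γ₁ Γ₂ Γ Δ E : Ctx G} {A B D : Ty G} (v : Term S Γ₁ A) (w : Term S Γ₂ B)
      (u : Term S (B :: A :: Δ) D) (s : Shuffle Γ₁ Γ₂ Γ) (t : Shuffle Γ Δ E) :
      BaseEq (.pm (.pair v w s) u t)
        ((u.inst w (.left (s.assoc t).2.1.symm)).inst v (s.assoc t).2.2.symm)
  /-- `pm v to x ⊗ y. u[x ⊗ y/z] = u[v/z]` -/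
  | pm_eta {Γ Δ E : Ctx G} {A B D : Ty G} (v : Term S Γ (.tensor A B))
      (u : Term S (.tensor A B :: Δ) D) (s : Shuffle Γ Δ E) :
      BaseEq
        (.pm v (u.inst (.pair (.var A) (.var B) (.right (.left .nil)))
          (.right (.right (Shuffle.leftAll Δ)))) s)
        (u.inst v s.symm)
  /-- `* to *. v = v` -/
  | star_beta {Γ : Ctx G} {A : Ty G} (v : Term S Γ A) :
      BaseEq (.letStar .star v (Shuffle.rightAll Γ)) v
  /-- `v to *. w[*/z] = w[v/z]` -/
  | star_eta {Γ Δ E : Ctx G} {A : Ty G} (v : Term S Γ .unit) (w : Term S (.unit :: Δ) A)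
      (s : Shuffle Γ Δ E) :
      BaseEq (.letStar v (w.inst .star (Shuffle.leftAll Δ)) s) (w.inst v s.symm)
  /-- `(λ x : A. v) w = v[w/x]` -/
  | lam_beta {Γ Δ E : Ctx G} {A B : Ty G} (v : Term S (A :: Γ) B) (w : Term S Δ A)
      (s : Shuffle Γ Δ E) :
      BaseEq (.app (.lam v) w s) (v.inst w s)
  /-- `λ x : A. (v x) = v` -/
  | lam_eta {Γ : Ctx G} {A B : Ty G} (v : Term S Γ (.lolli A B)) :
      BaseEq (.lam (.app v (.var A) (.right (Shuffle.leftAll Γ)))) v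
  /-- `u[v to *. w/z] = v to *. u[w/z]` -/
  | star_comm {Δ₁ Δ₂ Δ Γ E : Ctx G} {A B : Ty G} (v : Term S Δ₁ .unit) (w : Term S Δ₂ A)
      (u : Term S (A :: Γ) B) (s : Shuffle Δ₁ Δ₂ Δ) (t : Shuffle Γ Δ E) :
      BaseEq (u.inst (.letStar v w s) t)
        (.letStar v (u.inst w (s.assoc t.symm).2.1.symm) (s.assoc t.symm).2.2)
  /-- `u[pm v to x ⊗ y. w/z] = pm v to x ⊗ y. u[w/z]` -/
  | pm_comm {Δ₁ Δ₂ Δ Γ E : Ctx G} {A B D D' : Ty G} (v : Term S Δ₁ (.tensor A B))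
      (w : Term S (B :: A :: Δ₂) D) (u : Term S (D :: Γ) D') (s : Shuffle Δ₁ Δ₂ Δ)
      (t : Shuffle Γ Δ E) :
      BaseEq (u.inst (.pm v w s) t)
        (.pm v (u.inst w (.right (.right (s.assoc t.symm).2.1.symm))) (s.assoc t.symm).2.2)

end Operations

/-- A linear lambda-theory: ground types, operation symbols, and a class of
equations-in-context. -/
structure Theory where
  G : Type u
  S : Signature.{u, u'} G
  Ax : ∀ {Γ : Ctx G} {A : Ty G}, Term S Γ A → Term S Γ A → Prop

/-- A linear `Vλ`-theory: ground types, operation symbols, and a class of `V`-equations-in-context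
`Γ ▹ v =_q w : A` with label `q ∈ B`. -/
structure VTheory {V : Type w} (B : Set V) where
  G : Type u
  S : Signature.{u, u'} G
  Ax : ∀ {Γ : Ctx G} {A : Ty G}, Term S Γ A → Term S Γ A → B → Prop

mutual

/-- `T.Thm v w`: the equation `v = w` is a theorem of the linear lambda-theory `T`. -/
inductive Theory.Thm (T : Theory.{u, u'}) :
    ∀ {Γ : Ctx T.G} {A : Ty T.G}, Term T.S Γ A → Term T.S Γ A → Prop
  | ax {Γ A} {v w : Term T.S Γ A} (h : T.Ax v w) : Theory.Thm T v w
  | base {Γ A} {v w : Term T.S Γ A} (h : BaseEq v w) : Theory.Thm T v w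
  | refl {Γ A} (v : Term T.S Γ A) : Theory.Thm T v v
  | symm {Γ A} {v w : Term T.S Γ A} (h : Theory.Thm T v w) : Theory.Thm T w v
  | trans {Γ A} {v w u : Term T.S Γ A} (h : Theory.Thm T v w) (h' : Theory.Thm T w u) :
      Theory.Thm T v u
  | op (f : T.S.Op) {E} {vs ws : Args T.S E (T.S.dom f)} (h : Theory.ThmArgs T vs ws) :
      Theory.Thm T (.op f vs) (.op f ws)
  | pair {Γ Δ E A B} {v w : Term T.S Γ A} {v' w' : Term T.S Δ B} (s : Shuffle Γ Δ E)
      (h : Theory.Thm T v w) (h' : Theory.Thm T v' w') :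
      Theory.Thm T (.pair v v' s) (.pair w w' s)
  | pm {Γ Δ E A B D} {v w : Term T.S Γ (.tensor A B)} {v' w' : Term T.S (B :: A :: Δ) D}
      (s : Shuffle Γ Δ E) (h : Theory.Thm T v w) (h' : Theory.Thm T v' w') :
      Theory.Thm T (.pm v v' s) (.pm w w' s)
  | letStar {Γ Δ E A} {v w : Term T.S Γ .unit} {v' w' : Term T.S Δ A} (s : Shuffle Γ Δ E)
      (h : Theory.Thm T v w) (h' : Theory.Thm T v' w') :
      Theory.Thm T (.letStar v v' s) (.letStar w w' s)
  | lam {Γ A B} {v w : Term T.S (A :: Γ) B} (h : Theory.Thm T v w) :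
      Theory.Thm T (.lam v) (.lam w)
  | app {Γ Δ E A B} {v w : Term T.S Γ (.lolli A B)} {v' w' : Term T.S Δ A} (s : Shuffle Γ Δ E)
      (h : Theory.Thm T v w) (h' : Theory.Thm T v' w') :
      Theory.Thm T (.app v v' s) (.app w w' s)
  | exch {Γ Δ A} {v w : Term T.S Γ A} (p : Permut Γ Δ) (h : Theory.Thm T v w) :
      Theory.Thm T (v.permute p) (w.permute p)
  | subst {Γ Δ E A B} {v w : Term T.S (A :: Γ) B} {v' w' : Term T.S Δ A} (s : Shuffle Γ Δ E)
      (h : Theory.Thm T v w) (h' : Theory.Thm T v' w') :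
      Theory.Thm T (v.inst v' s) (w.inst w' s)

/-- Componentwise provable equality of tuples. -/
inductive Theory.ThmArgs (T : Theory.{u, u'}) :
    ∀ {E : Ctx T.G} {As : List (Ty T.G)}, Args T.S E As → Args T.S E As → Prop
  | nil : Theory.ThmArgs T .nil .nil
  | snoc {Γ Δ E As A} {vs ws : Args T.S Γ As} {v w : Term T.S Δ A} (s : Shuffle Γ Δ E)
      (h : Theory.ThmArgs T vs ws) (h' : Theory.Thm T v w) :
      Theory.ThmArgs T (.snoc vs v s) (.snoc ws w s)

end

/-- Provable equality of the terms `x : A ▹ v : B`. -/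
def Theory.homSetoid (T : Theory.{u, u'}) (A B : Ty T.G) : Setoid (Term T.S [A] B) where
  r v w := T.Thm v w
  iseqv := ⟨fun v => .refl v, fun h => .symm h, fun h h' => .trans h h'⟩

/-- The hom-class `Syn(T)(A, B)` of the syntactic category of a linear lambda-theory: terms
`x : A ▹ v : B` up to provable equality. -/
def Theory.SynHom (T : Theory.{u, u'}) (A B : Ty T.G) : Type (max u u') :=
  Quotient (T.homSetoid A B)

/-- The class of `v` in `Syn(T)(A, B)`. -/
def Theory.synMk (T : Theory.{u, u'}) {A B : Ty T.G} (v : Term T.S [A] B) : T.SynHom A B :=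
  Quotient.mk (T.homSetoid A B) v

section VTheories

variable {V : Type w} [CommMonoid V] [CompleteLattice V]

mutual

/-- `T.Thm v w q`: the `V`-equation `v =_q w` is a theorem of the linear `Vλ`-theory `T`. -/
inductive VTheory.Thm {B : Set V} (T : VTheory.{w, u, u'} B) :
    ∀ {Γ : Ctx T.G} {A : Ty T.G}, Term T.S Γ A → Term T.S Γ A → V → Prop
  | ax {Γ A} {v w : Term T.S Γ A} {q : B} (h : T.Ax v w q) : VTheory.Thm T v w q
  | base {Γ A} {v w : Term T.S Γ A} (h : BaseEq v w) : VTheory.Thm T v w ⊤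
  | base_symm {Γ A} {v w : Term T.S Γ A} (h : BaseEq v w) : VTheory.Thm T w v ⊤
  | refl {Γ A} (v : Term T.S Γ A) : VTheory.Thm T v v ⊤
  | trans {Γ A} {v w u : Term T.S Γ A} {q r : V} (h : VTheory.Thm T v w q)
      (h' : VTheory.Thm T w u r) : VTheory.Thm T v u (q * r)
  | weak {Γ A} {v w : Term T.S Γ A} {q r : V} (hr : r ∈ B) (hrq : r ≤ q)
      (h : VTheory.Thm T v w q) : VTheory.Thm T v w r
  | arch {Γ A} {v w : Term T.S Γ A} {q : V} (hq : q ∈ B)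
      (h : ∀ r ∈ B, WayBelow r q → VTheory.Thm T v w r) : VTheory.Thm T v w q
  | join {Γ A} {v w : Term T.S Γ A} (s : Finset V) (h : ∀ q ∈ s, VTheory.Thm T v w q) :
      VTheory.Thm T v w (s.sup id)
  | op (f : T.S.Op) {E} {vs ws : Args T.S E (T.S.dom f)} {q : V}
      (h : VTheory.ThmArgs T vs ws q) : VTheory.Thm T (.op f vs) (.op f ws) q
  | pair {Γ Δ E A A'} {v w : Term T.S Γ A} {v' w' : Term T.S Δ A'} {q r : V} (s : Shuffle Γ Δ E)
      (h : VTheory.Thm T v w q) (h' : VTheory.Thm T v' w' r) :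
      VTheory.Thm T (.pair v v' s) (.pair w w' s) (q * r)
  | pm {Γ Δ E A A' D} {v w : Term T.S Γ (.tensor A A')} {v' w' : Term T.S (A' :: A :: Δ) D}
      {q r : V} (s : Shuffle Γ Δ E) (h : VTheory.Thm T v w q) (h' : VTheory.Thm T v' w' r) :
      VTheory.Thm T (.pm v v' s) (.pm w w' s) (q * r)
  | letStar {Γ Δ E A} {v w : Term T.S Γ .unit} {v' w' : Term T.S Δ A} {q r : V}
      (s : Shuffle Γ Δ E) (h : VTheory.Thm T v w q) (h' : VTheory.Thm T v' w' r) :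
      VTheory.Thm T (.letStar v v' s) (.letStar w w' s) (q * r)
  | lam {Γ A A'} {v w : Term T.S (A :: Γ) A'} {q : V} (h : VTheory.Thm T v w q) :
      VTheory.Thm T (.lam v) (.lam w) q
  | app {Γ Δ E A A'} {v w : Term T.S Γ (.lolli A A')} {v' w' : Term T.S Δ A} {q r : V}
      (s : Shuffle Γ Δ E) (h : VTheory.Thm T v w q) (h' : VTheory.Thm T v' w' r) :
      VTheory.Thm T (.app v v' s) (.app w w' s) (q * r)
  | exch {Γ Δ A} {v w : Term T.S Γ A} {q : V} (p : Permut Γ Δ) (h : VTheory.Thm T v w q) :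
      VTheory.Thm T (v.permute p) (w.permute p) q
  | subst {Γ Δ E A A'} {v w : Term T.S (A :: Γ) A'} {v' w' : Term T.S Δ A} {q r : V}
      (s : Shuffle Γ Δ E) (h : VTheory.Thm T v w q) (h' : VTheory.Thm T v' w' r) :
      VTheory.Thm T (v.inst v' s) (w.inst w' s) (q * r)

/-- Componentwise `V`-equations between tuples; the label is the product of the labels. -/
inductive VTheory.ThmArgs {B : Set V} (T : VTheory.{w, u, u'} B) :
    ∀ {E : Ctx T.G} {As : List (Ty T.G)}, Args T.S E As → Args T.S E As → V → Prop
  | nil : VTheory.ThmArgs T .nil .nil 1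
  | snoc {Γ Δ E As A} {vs ws : Args T.S Γ As} {v w : Term T.S Δ A} {q r : V} (s : Shuffle Γ Δ E)
      (h : VTheory.ThmArgs T vs ws q) (h' : VTheory.Thm T v w r) :
      VTheory.ThmArgs T (.snoc vs v s) (.snoc ws w s) (q * r)

end

variable [IsQuantale V]

/-- The `V`-category of the terms `x : A ▹ v : A'`, with `a v w = ⋁ {q | v =_q w is a theorem}`. -/
def VTheory.termVCat {B : Set V} (T : VTheory.{w, u, u'} B) (A A' : Ty T.G) :
    VCatStr V (Term T.S [A] A') where
  a v w := sSup {q | T.Thm v w q}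
  one_le v := le_trans le_top (le_sSup (VTheory.Thm.refl v))
  mul_le v w u := by
    rw [sSup_mul_distrib]
    refine iSup₂_le fun q hq => ?_
    rw [mul_sSup_distrib]
    exact iSup₂_le fun r hr => le_sSup (VTheory.Thm.trans hq hr)

/-- The class of terms `x : A ▹ v : A'` modulo `v =_⊤ w` and `w =_⊤ v`: the underlying
class of the hom-object `Syn(T)(A, A')`. -/
abbrev VTheory.SynHom {B : Set V} (T : VTheory.{w, u, u'} B) (A A' : Ty T.G) :
    Type (max u u') :=
  (T.termVCat A A').SepQuot

/-- The separated hom-`V`-category `Syn(T)(A, A')`. -/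
def VTheory.synHom {B : Set V} (T : VTheory.{w, u, u'} B) (A A' : Ty T.G) :
    VCatStr V (T.SynHom A A') :=
  (T.termVCat A A').sepQuot

/-- The class of `v` in `Syn(T)(A, A')`. -/
def VTheory.synMk {B : Set V} (T : VTheory.{w, u, u'} B) {A A' : Ty T.G} (v : Term T.S [A] A') :
    T.SynHom A A' :=
  Quotient.mk (T.termVCat A A').sepSetoid v

/-- `T` is varietal (relative to the universe `v` of small sets): its separated
hom-`V`-categories of terms are small. -/
def VTheory.IsVarietal {B : Set V} (T : VTheory.{w, u, u'} B) : Prop :=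
  ∀ A A' : Ty T.G, (T.synHom A A').IsSmall.{w, v}

end VTheories

section Semantics

variable {G : Type u'} {C : Type u} [Category.{v} C] [MonoidalCategory C]

/-- Interpretation of types, given the interpretation of ground types. -/
def Ty.obj [MonoidalClosed C] (ob : G → C) : Ty G → C
  | .ground X => ob X
  | .unit => 𝟙_ C
  | .tensor A B => A.obj ob ⊗ B.obj ob
  | .lolli A B => (ihom (A.obj ob)).obj (B.obj ob)

/-- Interpretation of contexts by left-nested tensors. -/
def Ctx.obj [MonoidalClosed C] (ob : G → C) : List (Ty G) → C
  | [] => 𝟙_ C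
  | [A] => A.obj ob
  | A :: A' :: Γ => Ctx.obj ob (A' :: Γ) ⊗ A.obj ob

/-- The isomorphism `join : ⟦Γ⟧ ⊗ ⟦A⟧ ≅ ⟦Γ, x : A⟧`. -/
def Ctx.join [MonoidalClosed C] (ob : G → C) : ∀ (Γ : List (Ty G)) (A : Ty G),
    Ctx.obj ob Γ ⊗ A.obj ob ≅ Ctx.obj ob (A :: Γ)
  | [], A => λ_ (A.obj ob)
  | A' :: Γ, A => Iso.refl (Ctx.obj ob (A' :: Γ) ⊗ A.obj ob)

variable [SymmetricCategory C] [MonoidalClosed C]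

/-- For a shuffle `E` of `Γ` and `Δ`, the canonical morphism `⟦E⟧ ⟶ ⟦Γ⟧ ⊗ ⟦Δ⟧`, that is, the shuffling
morphism `⟦E⟧ ⟶ ⟦Γ, Δ⟧` followed by the splitting morphism. -/
def Shuffle.split (ob : G → C) : ∀ {Γ Δ E : List (Ty G)}, Shuffle Γ Δ E →
    (Ctx.obj ob E ⟶ Ctx.obj ob Γ ⊗ Ctx.obj ob Δ)
  | _, _, _, .nil => (λ_ (𝟙_ C)).inv
  | _, _, _, .left (A := A) (Γ := Γ) (Δ := Δ) (E := E) s =>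
    (Ctx.join ob E A).inv ≫ (s.split ob ▷ A.obj ob) ≫
      (α_ (Ctx.obj ob Γ) (Ctx.obj ob Δ) (A.obj ob)).hom ≫
      (Ctx.obj ob Γ ◁ (β_ (Ctx.obj ob Δ) (A.obj ob)).hom) ≫
      (α_ (Ctx.obj ob Γ) (A.obj ob) (Ctx.obj ob Δ)).inv ≫
      ((Ctx.join ob Γ A).hom ▷ Ctx.obj ob Δ)
  | _, _, _, .right (A := A) (Γ := Γ) (Δ := Δ) (E := E) s =>
    (Ctx.join ob E A).inv ≫ (s.split ob ▷ A.obj ob) ≫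
      (α_ (Ctx.obj ob Γ) (Ctx.obj ob Δ) (A.obj ob)).hom ≫
      (Ctx.obj ob Γ ◁ (Ctx.join ob Δ A).hom)

variable (C) in
/-- An interpretation of ground types and operation symbols in the autonomous category `C`. -/
structure Interpretation (S : Signature.{u', w} G) where
  ob : G → C
  op : ∀ f : S.Op, Ctx.obj ob (S.dom f) ⟶ (S.cod f).obj ob

variable {S : Signature.{u', w} G}

mutual

/-- Interpretation of judgements, `⟦Γ ▹ v : A⟧ : ⟦Γ⟧ ⟶ ⟦A⟧`. -/
def Term.interp (I : Interpretation C S) : ∀ {Γ : Ctx G} {A : Ty G}, Term S Γ A →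
    (Ctx.obj I.ob Γ ⟶ A.obj I.ob)
  | _, _, .op f vs => vs.interp I ≫ I.op f
  | _, _, .var A => 𝟙 (A.obj I.ob)
  | _, _, .star => 𝟙 (𝟙_ C)
  | _, _, .letStar (Δ := Δ) v w s =>
    s.split I.ob ≫ (v.interp I ▷ Ctx.obj I.ob Δ) ≫ (λ_ (Ctx.obj I.ob Δ)).hom ≫ w.interp I
  | _, _, .pair v w s => s.split I.ob ≫ (v.interp I ⊗ₘ w.interp I)
  | _, _, .pm (Δ := Δ) (A := A) (B := B) v w s =>
    s.split I.ob ≫ (v.interp I ▷ Ctx.obj I.ob Δ) ≫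
      (β_ (A.obj I.ob ⊗ B.obj I.ob) (Ctx.obj I.ob Δ)).hom ≫
      (α_ (Ctx.obj I.ob Δ) (A.obj I.ob) (B.obj I.ob)).inv ≫
      ((Ctx.join I.ob Δ A).hom ▷ B.obj I.ob) ≫ (Ctx.join I.ob (A :: Δ) B).hom ≫ w.interp I
  | _, _, .lam (Γ := Γ) (A := A) v => transpose ((Ctx.join I.ob Γ A).hom ≫ v.interp I)
  | _, _, .app (A := A) (B := B) v w s =>
    s.split I.ob ≫ (v.interp I ⊗ₘ w.interp I) ≫ application (A.obj I.ob) (B.obj I.ob)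

/-- Interpretation of tuples, `⟦E⟧ ⟶ ⟦A₁⟧ ⊗ ⋯ ⊗ ⟦Aₙ⟧`. -/
def Args.interp (I : Interpretation C S) : ∀ {E : Ctx G} {As : List (Ty G)}, Args S E As →
    (Ctx.obj I.ob E ⟶ Ctx.obj I.ob As)
  | _, _, .nil => 𝟙 (𝟙_ C)
  | _, _, .snoc (As := As) (A := A) vs v s =>
    s.split I.ob ≫ (vs.interp I ⊗ₘ v.interp I) ≫ (Ctx.join I.ob As A).hom

end

end Semantics

section InternalLanguage

variable (C : Type u) [Category.{v} C] [MonoidalCategory C] [SymmetricCategory C]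
  [MonoidalClosed C]

/-- The operation symbols of `Lang(C)`: the morphisms of `C`, and for every type `A` the two
directions of an isomorphism `A ≃ i(A)`. -/
inductive LangOp : Type (max u v)
  | mor {X Y : C} (f : X ⟶ Y) : LangOp
  | toObj (A : Ty C) : LangOp
  | ofObj (A : Ty C) : LangOp

/-- The signature of `Lang(C)`; the object `i(A)` of `C` is `A.obj id`. -/
def langSignature : Signature.{u, max u v} C where
  Op := LangOp C
  dom
    | .mor (X := X) _ => [.ground X]
    | .toObj A => [A]
    | .ofObj A => [.ground (A.obj id)]
  dom_ne_nil f := by cases f <;> simp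
  cod
    | .mor (Y := Y) _ => .ground Y
    | .toObj A => .ground (A.obj id)
    | .ofObj A => A

/-- The obvious interpretation of `Lang(C)` in `C`. -/
def langInterp : Interpretation C (langSignature C) where
  ob := id
  op
    | .mor f => f
    | .toObj A => 𝟙 (A.obj id)
    | .ofObj A => 𝟙 (A.obj id)

/-- The linear lambda-theory of `C`; its axioms are all the equations-in-context satisfied by the
obvious interpretation. -/
def langLambda : Theory.{u, max u v} where
  G := C
  S := langSignature C
  Ax v w := v.interp (langInterp C) = w.interp (langInterp C)

variable {C}

/-- The linear `Vλ`-theory `Lang(C)`; its axioms are all the `V`-equations-in-context satisfied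
by the obvious interpretation. -/
def lang {V : Type w} [CommMonoid V] [CompleteLattice V] [IsQuantale V] (B : Set V)
    (𝓔 : VCatSepAutonomous V C) : VTheory.{w, u, max u v} B where
  G := C
  S := langSignature C
  Ax {_ _} v w q := (q : V) ≤ (𝓔.hom _ _).a (v.interp (langInterp C)) (w.interp (langInterp C))

end InternalLanguage

end LinearLambda

-- The point is that `lang B 𝓔` has every satisfied `V`-equation as an axiom. If two terms have the
-- same interpretation `f`, then reflexivity `k ≤ a(f, f)` together with `k ∈ B` makes both `t =_k
-- t'` and `t' =_k t` axioms, so the two terms have the same class in the separated quotient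
-- (`lang_thm_one_of_interp_eq`). A class is therefore determined by the interpretation of any one
-- of its members. Choosing a representative in each class and interpreting it embeds the possibly
-- large hom-class into a hom-set of `C`, which is small. Soundness of the calculus plays no role
-- here: it is not necessary to know that the interpretation is constant on classes.
--
-- For the comparison map, both hom-classes are quotients of the same class of terms, so
-- surjectivity is automatic and only well-definedness has content. It amounts to replaying an
-- ordinary derivation in the `V`-calculus with every label equal to `k`
-- (`lang_thm_one_of_langLambda_thm`). Labels never degrade, because `k ⊗ k = k`, and the label `⊤`
-- of the base equations is `k` by integrality. As `V`-equations are directed, the induction derives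
-- both directions at once.

namespace LinearLambda

section InternalLanguage

variable {V : Type w} [CommMonoid V] [CompleteLattice V] [IsQuantale V] {B : Set V}
  {C : Type u} [Category.{v} C] [MonoidalCategory C] [SymmetricCategory C] [MonoidalClosed C]

-- Equal interpretations give provability with label `k`

/-- Terms with the same interpretation are provably equal, with label `1`, in `Lang(C)`. -/
theorem lang_thm_one_of_interp_eq (hBone : (1 : V) ∈ B) (𝓔 : VCatSepAutonomous V C)
    {Γ : Ctx C} {A : Ty C} {t t' : Term (langSignature C) Γ A}
    (h : t.interp (langInterp C) = t'.interp (langInterp C)) :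
    (lang B 𝓔).Thm t t' (1 : V) := by
  -- Axiom labels range over `B` only, so the label `k` is available as an axiom label because `k ∈
  -- B`.
  refine VTheory.Thm.ax (T := lang B 𝓔) (q := ⟨1, hBone⟩) ?_
  change (1 : V) ≤ (𝓔.hom _ _).a (t.interp (langInterp C)) (t'.interp (langInterp C))
  rw [h]
  exact (𝓔.hom _ _).one_le _

-- Translation of ordinary derivations into derivations with label `k`

mutual

/-- Theorems of the linear lambda-theory of `C` are, in both directions, theorems of `Lang(C)` with
label `1`. -/
theorem lang_thm_one_of_langLambda_thm (hint : (1 : V) = ⊤) (hBone : (1 : V) ∈ B)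
    (𝓔 : VCatSepAutonomous V C) :
    ∀ {Γ : Ctx C} {A : Ty C} {t t' : Term (langSignature C) Γ A}, (langLambda C).Thm t t' →
      (lang B 𝓔).Thm t t' (1 : V) ∧ (lang B 𝓔).Thm t' t (1 : V)
  | _, _, _, _, .ax h =>
    ⟨lang_thm_one_of_interp_eq hBone 𝓔 h, lang_thm_one_of_interp_eq hBone 𝓔 (Eq.symm h)⟩
  -- The calculus supplies base equations and reflexivity with label `⊤`; integrality identifies it
  -- with `k`.
  | _, _, _, _, .base h => by
    rw [hint]
    exact ⟨.base h, .base_symm h⟩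
  | _, _, _, _, .refl t => by
    rw [hint]
    exact ⟨.refl (T := lang B 𝓔) t, .refl (T := lang B 𝓔) t⟩
  -- The `V`-calculus has no symmetry rule. This case is why the induction hypothesis carries both
  -- directions: symmetry merely swaps them.
  | _, _, _, _, .symm h => (lang_thm_one_of_langLambda_thm hint hBone 𝓔 h).symm
  | _, _, _, _, .trans h h' => by
    have i := lang_thm_one_of_langLambda_thm hint hBone 𝓔 h
    have i' := lang_thm_one_of_langLambda_thm hint hBone 𝓔 h'
    -- Rules with two premises multiply labels, so the target label `k` is first written as `k ⊗ k`.
    rw [← mul_one (1 : V)]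
    exact ⟨.trans i.1 i'.1, .trans i'.2 i.2⟩
  -- An operation symbol passes on the label of its tuple of arguments unchanged; controlling that
  -- label is the task of the companion statement for tuples.
  | _, _, _, _, .op f h =>
    have i := lang_thmArgs_one_of_langLambda_thmArgs hint hBone 𝓔 h
    ⟨.op (T := lang B 𝓔) f i.1, .op (T := lang B 𝓔) f i.2⟩
  | _, _, _, _, .pair s h h' => by
    have i := lang_thm_one_of_langLambda_thm hint hBone 𝓔 h
    have i' := lang_thm_one_of_langLambda_thm hint hBone 𝓔 h'
    rw [← mul_one (1 : V)]
    exact ⟨.pair s i.1 i'.1, .pair s i.2 i'.2⟩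
  | _, _, _, _, .pm s h h' => by
    have i := lang_thm_one_of_langLambda_thm hint hBone 𝓔 h
    have i' := lang_thm_one_of_langLambda_thm hint hBone 𝓔 h'
    rw [← mul_one (1 : V)]
    exact ⟨.pm s i.1 i'.1, .pm s i.2 i'.2⟩
  | _, _, _, _, .letStar s h h' => by
    have i := lang_thm_one_of_langLambda_thm hint hBone 𝓔 h
    have i' := lang_thm_one_of_langLambda_thm hint hBone 𝓔 h'
    rw [← mul_one (1 : V)]
    exact ⟨.letStar s i.1 i'.1, .letStar s i.2 i'.2⟩
  | _, _, _, _, .lam h =>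
    have i := lang_thm_one_of_langLambda_thm hint hBone 𝓔 h
    ⟨.lam i.1, .lam i.2⟩
  | _, _, _, _, .app s h h' => by
    have i := lang_thm_one_of_langLambda_thm hint hBone 𝓔 h
    have i' := lang_thm_one_of_langLambda_thm hint hBone 𝓔 h'
    rw [← mul_one (1 : V)]
    exact ⟨.app s i.1 i'.1, .app s i.2 i'.2⟩
  | _, _, _, _, .exch p h =>
    have i := lang_thm_one_of_langLambda_thm hint hBone 𝓔 h
    ⟨.exch p i.1, .exch p i.2⟩
  | _, _, _, _, .subst s h h' => by
    have i := lang_thm_one_of_langLambda_thm hint hBone 𝓔 h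
    have i' := lang_thm_one_of_langLambda_thm hint hBone 𝓔 h'
    rw [← mul_one (1 : V)]
    exact ⟨.subst s i.1 i'.1, .subst s i.2 i'.2⟩

/-- The version of `lang_thm_one_of_langLambda_thm` for tuples of terms. -/
theorem lang_thmArgs_one_of_langLambda_thmArgs (hint : (1 : V) = ⊤) (hBone : (1 : V) ∈ B)
    (𝓔 : VCatSepAutonomous V C) :
    ∀ {E : Ctx C} {As : List (Ty C)} {ts ts' : Args (langSignature C) E As},
      (langLambda C).ThmArgs ts ts' →
        (lang B 𝓔).ThmArgs ts ts' (1 : V) ∧ (lang B 𝓔).ThmArgs ts' ts (1 : V)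
  -- The label of a tuple is the product of the labels of its entries, and the empty product is
  -- already `k`.
  | _, _, _, _, .nil => ⟨.nil, .nil⟩
  | _, _, _, _, .snoc s h h' => by
    have i := lang_thmArgs_one_of_langLambda_thmArgs hint hBone 𝓔 h
    have i' := lang_thm_one_of_langLambda_thm hint hBone 𝓔 h'
    rw [← mul_one (1 : V)]
    exact ⟨.snoc s i.1 i'.1, .snoc s i.2 i'.2⟩

end

-- Passage to the separated quotient: smallness and the comparison map

/-- The distance `a` is a join over all provable labels, so a single theorem with label `k` in each
direction already puts both distances above `k`. -/
theorem lang_synMk_eq_of_thm_one (𝓔 : VCatSepAutonomous V C) {A A' : Ty C}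
    {t t' : Term (langSignature C) [A] A'} (h : (lang B 𝓔).Thm t t' (1 : V))
    (h' : (lang B 𝓔).Thm t' t (1 : V)) :
    (lang B 𝓔).synMk t = (lang B 𝓔).synMk t' :=
  Quotient.sound ⟨le_sSup h, le_sSup h'⟩

/-- `Lang(C)` is varietal: the interpretations of chosen representatives embed
`Syn(Lang(C))(A, A')` into a hom-set of `C`. -/
theorem lang_isVarietal (hBone : (1 : V) ∈ B) (𝓔 : VCatSepAutonomous V C) :
    (lang B 𝓔).IsVarietal.{w, v} := by
  intro A A'
  -- The representative is fixed by choice, so the map is defined without any invariance of the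
  -- interpretation. Its target is a hom-set of `C`, hence small.
  refine small_of_injective (β := Ctx.obj (langInterp C).ob [A] ⟶ Ty.obj (langInterp C).ob A')
    (f := fun x : (lang B 𝓔).SynHom A A' => Term.interp (langInterp C) (Quotient.out x)) ?_
  intro x y h
  -- The hypothesis concerns the chosen representatives, so each class is rewritten as the class of
  -- its own.
  rw [← Quotient.out_eq x, ← Quotient.out_eq y]
  exact lang_synMk_eq_of_thm_one 𝓔 (lang_thm_one_of_interp_eq hBone 𝓔 h)
    (lang_thm_one_of_interp_eq hBone 𝓔 (Eq.symm h))

/-- The comparison map from the syntactic category of the linear lambda-theory of `C`. -/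
def langComparison (hint : (1 : V) = ⊤) (hBone : (1 : V) ∈ B) (𝓔 : VCatSepAutonomous V C)
    (A A' : Ty C) : (langLambda C).SynHom A A' → (lang B 𝓔).SynHom A A' :=
  Quotient.lift (fun t : Term (langSignature C) [A] A' => (lang B 𝓔).synMk t) fun _ _ h =>
    have i := lang_thm_one_of_langLambda_thm hint hBone 𝓔 h
    lang_synMk_eq_of_thm_one 𝓔 i.1 i.2

end InternalLanguage

end LinearLambda

theorem mainTheorem5 (V : Type w) [CommMonoid V] [CompleteLattice V] [IsQuantale V]
    (hcont : IsContinuousLattice V) (hint : (1 : V) = ⊤)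
    (B : Set V) (hB : IsLatticeBasis B)
    (hBsup : ∀ s : Finset V, (s : Set V) ⊆ B → s.sup id ∈ B)
    (hBmul : ∀ q ∈ B, ∀ r ∈ B, q * r ∈ B) (hBone : (1 : V) ∈ B)
    (C : Type u) [Category.{v} C] [MonoidalCategory C] [SymmetricCategory C] [MonoidalClosed C]
    (𝓔 : VCatSepAutonomous V C) :
    (LinearLambda.lang B 𝓔).IsVarietal.{w, v} ∧
      ∀ A A' : LinearLambda.Ty C,
        ∃ φ : (LinearLambda.langLambda C).SynHom A A' → (LinearLambda.lang B 𝓔).SynHom A A',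
          (∀ t : LinearLambda.Term (LinearLambda.langSignature C) [A] A',
            φ ((LinearLambda.langLambda C).synMk t) = (LinearLambda.lang B 𝓔).synMk t) ∧
          Function.Surjective φ := by
  refine ⟨LinearLambda.lang_isVarietal hBone 𝓔, fun A A' =>
    ⟨LinearLambda.langComparison hint hBone 𝓔 A A', fun t => rfl, ?_⟩⟩
  -- The two theories share their types and terms, so a representative of a class on the right also
  -- names a class on the left.
  rintro ⟨t⟩
  exact ⟨(LinearLambda.langLambda C).synMk t, rfl⟩
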